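/- For a smooth vector field $w=(w_1,w_2)$ and a smooth symmetric 2-tensor field $u=(u_{ij})_{i,j=1,2}$ on $\mathbb{R}^2$ with compact support, the ray transforms are $$Iw(X,\xi)=\int_{\mathbb{R}} \sum_{m} w_m(X+t\xi)\,\xi_m\,dt,\qquad Iu(X,\xi)=\int_{\mathbb{R}} \sum_{m,n} u_{mn}(X+t\xi)\,\xi_m\xi_n\,dt,$$ where $X,\xi\in\mathbb{R}^2$ and $|\xi|=1$. All fields are real-valued, and the support of a field is the closure of the set where it is nonzero. **A.** Let $w$ be a smooth vector field on $\mathbb{R}^2$ with compact support. Then the following statements are equivalent: (a) $Iw(X,\xi)=0$ for all $X\in\mathbb{R}^2$ and all unit vectors $\xi\in\mathbb{R}^2$; (b) there exists a smooth compactly supported scalar field $\phi$ on $\mathbb{R}^2$, whose support is contained in the convex hull of the support of $w$, such that $w_i=\partial_i\phi$ for $i=1,2$; (c) $\partial_1w_2-\partial_2w_1=0$ on $\mathbb{R}^2$. **B.** Let $u$ be a smooth symmetric 2-tensor field on $\mathbb{R}^2$ with compact support. Then the following statements are equivalent: (a) $Iu(X,\xi)=0$ for all $X\in\mathbb{R}^2$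 and all unit vectors $\xi\in\mathbb{R}^2$; (b) there exists a smooth compactly supported vector field $v$ on $\mathbb{R}^2$, whose support is contained in the convex hull of the support of $u$, such that $u_{ij}=\tfrac12(\partial_iv_j+\partial_jv_i)$ for $i,j=1,2$; (c) $\partial_1^2u_{22}+\partial_2^2u_{11}-2\,\partial_1\partial_2u_{12}=0$ on $\mathbb{R}^2$. -/

import Mathlib

open scoped ContDiff

namespace RayKernel

/-- The Euclidean plane. -/
abbrev Plane : Type := EuclideanSpace ℝ (Fin 2)

/-- The partial derivative `∂ᵢ f` of a scalar function on the plane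
(the indices `0, 1` stand for the coordinate directions 1, 2). -/
noncomputable def partialDeriv (i : Fin 2) (f : Plane → ℝ) (x : Plane) : ℝ :=
  fderiv ℝ f x (EuclideanSpace.single i 1)

/-- The ray transform `Iw(X, ξ) = ∫ dt wₘ(X + tξ) ξₘ` of a vector field. -/
noncomputable def vectorRayTransform (w : Plane → Plane) (X ξ : Plane) : ℝ :=
  ∫ t : ℝ, ∑ m : Fin 2, w (X + t • ξ) m * ξ m

/-- The ray transform `Iu(X, ξ) = ∫ dt uₘₙ(X + tξ) ξₘ ξₙ` of a 2-tensor field. -/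
noncomputable def tensorRayTransform (u : Plane → Matrix (Fin 2) (Fin 2) ℝ) (X ξ : Plane) : ℝ :=
  ∫ t : ℝ, ∑ m : Fin 2, ∑ n : Fin 2, u (X + t • ξ) m n * ξ m * ξ n

end RayKernel

namespace RayKernel

open MeasureTheory FourierTransform Set


/-! The implications form a cycle. (a) ⇒ (c) is the Fourier slice argument: if the line integrals
along `ξ` vanish, so does the Fourier transform of the contracted field at every `ζ ⊥ ξ`
(`realFourier_eq_zero_of_integral_line`). In the plane `ζ` determines `ξ` up to sign, and the
contraction with `ξ` is, up to a factor, the symbol of the curl or Saint-Venant operator at `ζ`;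
Fourier inversion gives (c).

(c) ⇒ (b) is the Poincaré lemma with supports (`exists_potential`): a primitive is constant off the
compact convex hull, whose complement is connected, and that constant is subtracted. For tensors it
is applied three times (`exists_tensor_potential`): to recover the rotation of the unknown field,
then each of its components.

(b) ⇒ (a) is the fundamental theorem of calculus on lines (`integral_line_fderiv_eq_zero`). -/

/-! ### Partial derivatives and integrals along lines. -/

theorem eq_sum_single (v : Plane) :
    v = v 0 • EuclideanSpace.single 0 1 + v 1 • EuclideanSpace.single 1 1 := by
  ext i
  fin_cases i <;> simp

theorem fderiv_apply_eq (f : Plane → ℝ) (x v : Plane) :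
    fderiv ℝ f x v = v 0 * partialDeriv 0 f x + v 1 * partialDeriv 1 f x := by
  conv_lhs => rw [eq_sum_single v]
  simp [partialDeriv]

theorem contDiff_partialDeriv {f : Plane → ℝ} (hf : ContDiff ℝ ∞ f) (i : Fin 2) :
    ContDiff ℝ ∞ (partialDeriv i f) :=
  (hf.fderiv_right (m := ∞) (by simp)).clm_apply contDiff_const

theorem hasCompactSupport_partialDeriv {f : Plane → ℝ} (hf : HasCompactSupport f) (i : Fin 2) :
    HasCompactSupport (partialDeriv i f) :=
  hf.fderiv_apply ℝ _

theorem partialDeriv_eq_zero_of_notMem {f : Plane → ℝ} {x : Plane} (i : Fin 2)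
    (hx : x ∉ tsupport f) : partialDeriv i f x = 0 := by
  rw [partialDeriv, fderiv_of_notMem_tsupport ℝ hx]
  simp

theorem partialDeriv_comm {f : Plane → ℝ} (hf : ContDiff ℝ ∞ f) (i j : Fin 2) (x : Plane) :
    partialDeriv i (partialDeriv j f) x = partialDeriv j (partialDeriv i f) x := by
  have hd : DifferentiableAt ℝ (fderiv ℝ f) x :=
    (hf.fderiv_right (m := ∞) (by simp)).differentiable (by simp) x
  have key (v w : Plane) :
      fderiv ℝ (fun y => fderiv ℝ f y v) x w = fderiv ℝ (fderiv ℝ f) x w v := by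
    rw [fderiv_clm_apply hd (differentiableAt_const v)]
    simp
  have hs : IsSymmSndFDerivAt ℝ f x := hf.contDiffAt.isSymmSndFDerivAt
    (by simpa using ENat.LEInfty.out)
  change fderiv ℝ (fun y => fderiv ℝ f y _) x _ = fderiv ℝ (fun y => fderiv ℝ f y _) x _
  rw [key, key, hs]

theorem partialDeriv_add {f g : Plane → ℝ} (hf : ContDiff ℝ ∞ f) (hg : ContDiff ℝ ∞ g)
    (i : Fin 2) (x : Plane) :
    partialDeriv i (fun y => f y + g y) x = partialDeriv i f x + partialDeriv i g x := by
  rw [partialDeriv, fderiv_fun_add (hf.differentiable (by simp) x) (hg.differentiable (by simp) x)]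
  rfl

theorem partialDeriv_sub {f g : Plane → ℝ} (hf : ContDiff ℝ ∞ f) (hg : ContDiff ℝ ∞ g)
    (i : Fin 2) (x : Plane) :
    partialDeriv i (fun y => f y - g y) x = partialDeriv i f x - partialDeriv i g x := by
  rw [partialDeriv, fderiv_fun_sub (hf.differentiable (by simp) x) (hg.differentiable (by simp) x)]
  rfl

theorem partialDeriv_const_mul {f : Plane → ℝ} (hf : ContDiff ℝ ∞ f) (c : ℝ)
    (i : Fin 2) (x : Plane) :
    partialDeriv i (fun y => c * f y) x = c * partialDeriv i f x := by
  rw [partialDeriv, fderiv_const_mul (hf.differentiable (by simp) x)]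
  rfl

/-- The line derivative of a compactly supported function integrates to zero along lines. -/
theorem integral_line_fderiv_eq_zero {f : Plane → ℝ} (hf : ContDiff ℝ ∞ f)
    (hc : HasCompactSupport f) (X : Plane) {ξ : Plane} (hξ : ‖ξ‖ = 1) :
    ∫ t : ℝ, fderiv ℝ f (X + t • ξ) ξ = 0 := by
  have hemb : Topology.IsClosedEmbedding (fun t : ℝ => X + t • ξ) :=
    (Homeomorph.addLeft X).isClosedEmbedding.comp
      (isClosedEmbedding_smul_left (by rintro rfl; simp at hξ))
  have hcont : Continuous fun t : ℝ => X + t • ξ := hemb.continuous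
  refine integral_eq_zero_of_hasDerivAt_of_integrable (f := fun t : ℝ => f (X + t • ξ))
    (fun t => ?_) ?_ ?_
  · have h1 : HasDerivAt (fun t : ℝ => X + t • ξ) ξ t := by
      simpa using ((hasDerivAt_id t).smul_const ξ).const_add X
    exact (hf.differentiable (by simp) _).hasFDerivAt.comp_hasDerivAt t h1
  · refine Continuous.integrable_of_hasCompactSupport ?_
      ((hc.fderiv_apply ℝ ξ).comp_isClosedEmbedding hemb)
    exact ((hf.continuous_fderiv (by simp)).comp hcont).clm_apply continuous_const
  · exact (hf.continuous.comp hcont).integrable_of_hasCompactSupport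
      (hc.comp_isClosedEmbedding hemb)

/-! ### Fourier transform and the slice property. -/

/-- The Fourier transform of a real-valued function on the plane. -/
noncomputable def realFourier (f : Plane → ℝ) : Plane → ℂ := 𝓕 (fun x => (f x : ℂ))

theorem hasCompactSupport_ofReal {f : Plane → ℝ} (hc : HasCompactSupport f) :
    HasCompactSupport (fun x => (f x : ℂ)) :=
  hc.comp_left (g := fun r : ℝ => (r : ℂ)) (by simp)

theorem contDiff_ofReal {f : Plane → ℝ} (hf : ContDiff ℝ ∞ f) :
    ContDiff ℝ ∞ (fun x => (f x : ℂ)) :=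
  Complex.ofRealCLM.contDiff.comp hf

theorem integrable_ofReal {f : Plane → ℝ} (hf : Continuous f) (hc : HasCompactSupport f) :
    Integrable (fun x => (f x : ℂ)) :=
  (Complex.continuous_ofReal.comp hf).integrable_of_hasCompactSupport (hasCompactSupport_ofReal hc)

theorem realFourier_partialDeriv {f : Plane → ℝ} (hf : ContDiff ℝ ∞ f)
    (hc : HasCompactSupport f) (i : Fin 2) (ζ : Plane) :
    realFourier (partialDeriv i f) ζ = 2 * Real.pi * Complex.I * ζ i * realFourier f ζ := by
  have hS : fderiv ℝ (fun x => (f x : ℂ)) =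
      fun x => Complex.ofRealCLM.comp (fderiv ℝ f x) := by
    ext1 x
    exact (Complex.ofRealCLM.hasFDerivAt.comp x
      (hf.differentiable (by simp) x).hasFDerivAt).fderiv
  have hint : Integrable (fderiv ℝ (fun x => (f x : ℂ))) :=
    ((contDiff_ofReal hf).continuous_fderiv (by simp)).integrable_of_hasCompactSupport
      ((hasCompactSupport_ofReal hc).fderiv ℝ)
  have h := Real.fourier_fderiv (integrable_ofReal hf.continuous hc)
    ((contDiff_ofReal hf).differentiable (by simp)) hint
  have h2 := congrArg (fun T => T (EuclideanSpace.single i 1)) (congrFun h ζ)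
  rw [Real.fourier_continuousLinearMap_apply hint] at h2
  rw [hS] at h2
  simp [VectorFourier.fourierSMulRight_apply] at h2
  rw [innerSL_apply_apply, EuclideanSpace.inner_single_right] at h2
  simp only [realFourier, partialDeriv]
  rw [h2]
  simp [mul_assoc]

/-- Fourier inversion: the zero transform is integrable, and continuity makes the formula hold at
every point. -/
theorem eq_zero_of_realFourier_eq_zero {f : Plane → ℝ} (hf : Continuous f)
    (hc : HasCompactSupport f) (h : ∀ ζ, realFourier f ζ = 0) (x : Plane) : f x = 0 := by
  have h0 : 𝓕 (fun x => (f x : ℂ)) = 0 := funext h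
  have := congrFun (Continuous.fourierInv_fourier_eq (Complex.continuous_ofReal.comp hf)
    (integrable_ofReal hf hc) (by
      change Integrable (𝓕 (fun x => (f x : ℂ)))
      rw [h0]; exact integrable_zero _ _ _)) x
  change 𝓕⁻ (𝓕 (fun x => (f x : ℂ))) x = (f x : ℂ) at this
  rw [h0] at this
  simpa [Real.fourierInv_eq] using this.symm

theorem realFourier_add {f g : Plane → ℝ} (hf : Continuous f) (hcf : HasCompactSupport f)
    (hg : Continuous g) (hcg : HasCompactSupport g) (ζ : Plane) :
    realFourier (fun x => f x + g x) ζ = realFourier f ζ + realFourier g ζ := by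
  have hF := (Real.fourierIntegral_convergent_iff ζ).2 (integrable_ofReal hf hcf)
  have hG := (Real.fourierIntegral_convergent_iff ζ).2 (integrable_ofReal hg hcg)
  simp only [realFourier, Real.fourier_eq, Complex.ofReal_add, smul_add]
  exact integral_add hF hG

theorem realFourier_const_mul (c : ℝ) (f : Plane → ℝ) (ζ : Plane) :
    realFourier (fun x => c * f x) ζ = c * realFourier f ζ := by
  simp only [realFourier, Real.fourier_eq, Complex.ofReal_mul]
  rw [← integral_const_mul]
  simp only [Circle.smul_def, smul_eq_mul]
  congr 1; ext x; ring

/-- Coordinates on the plane in the orthonormal frame `(ξ, Jξ)`. -/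
theorem integral_eq_integral_frame {G : Plane → ℂ} (hG : Integrable G) {ξ : Plane}
    (hξ : ‖ξ‖ = 1) :
    ∫ x, G x = ∫ p : ℝ, ∫ t : ℝ, G (p • !₂[-ξ 1, ξ 0] + t • ξ) := by
  have hn : ξ 0 ^ 2 + ξ 1 ^ 2 = 1 := by
    have := EuclideanSpace.real_norm_sq_eq ξ
    rw [hξ] at this
    simpa using this.symm
  have ho : Orthonormal ℝ ![(!₂[-ξ 1, ξ 0] : Plane), ξ] := by
    constructor
    · intro i
      fin_cases i
      · simp [EuclideanSpace.norm_eq]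
        linarith
      · simpa using hξ
    · intro i j hij
      fin_cases i <;> fin_cases j <;> simp_all [PiLp.inner_apply, mul_comm]
  let b : OrthonormalBasis (Fin 2) ℝ Plane :=
    (basisOfOrthonormalOfCardEqFinrank ho (by simp)).toOrthonormalBasis (by simpa using ho)
  have hb0 : b 0 = !₂[-ξ 1, ξ 0] := by simp [b]
  have hb1 : b 1 = ξ := by simp [b]
  let e : Plane ≃ᵐ ℝ × ℝ := (b.measurableEquiv.trans
    (MeasurableEquiv.toLp 2 (Fin 2 → ℝ)).symm).trans MeasurableEquiv.finTwoArrow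
  have he : MeasurePreserving e :=
    (b.measurePreserving_measurableEquiv.trans
      (EuclideanSpace.volume_preserving_symm_measurableEquiv_toLp _)).trans
      (volume_preserving_finTwoArrow ℝ)
  have hsymm (q : ℝ × ℝ) : e.symm q = q.1 • !₂[-ξ 1, ξ 0] + q.2 • ξ := by
    rw [MeasurableEquiv.symm_apply_eq]
    have h (i : Fin 2) : b.repr (q.1 • !₂[-ξ 1, ξ 0] + q.2 • ξ) i = ![q.1, q.2] i := by
      rw [← hb0, ← hb1]
      simp only [map_add, map_smul, b.repr_self]
      fin_cases i <;> simp
    exact (Prod.ext (h 0) (h 1)).symm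
  rw [← he.symm.integral_comp e.symm.measurableEmbedding, Measure.volume_eq_prod, integral_prod]
  · simp only [hsymm]
  · exact (he.symm.integrable_comp_emb e.symm.measurableEmbedding).2 hG

/-- The Fourier slice property in one direction: vanishing line integrals along `ξ` force the
Fourier transform to vanish on the orthogonal of `ξ`. -/
theorem realFourier_eq_zero_of_integral_line {g : Plane → ℝ} (hg : Continuous g)
    (hc : HasCompactSupport g) {ξ : Plane} (hξ : ‖ξ‖ = 1)
    (h : ∀ X : Plane, ∫ t : ℝ, g (X + t • ξ) = 0) {ζ : Plane} (hζ : inner ℝ ξ ζ = 0) :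
    realFourier g ζ = 0 := by
  have hF := (Real.fourierIntegral_convergent_iff ζ).2 (integrable_ofReal hg hc)
  rw [realFourier, Real.fourier_eq, integral_eq_integral_frame hF hξ]
  have hzero (p : ℝ) : ∫ t : ℝ, Real.fourierChar (-inner ℝ (p • !₂[-ξ 1, ξ 0] + t • ξ) ζ) •
      (g (p • !₂[-ξ 1, ξ 0] + t • ξ) : ℂ) = 0 := by
    -- The phase is constant along `ξ` because `ζ ⊥ ξ`, so it leaves the inner integral.
    have hi (t : ℝ) : inner ℝ (p • !₂[-ξ 1, ξ 0] + t • ξ) ζ =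
        inner ℝ (p • (!₂[-ξ 1, ξ 0] : Plane)) ζ := by
      rw [inner_add_left, real_inner_smul_left ξ, hζ, mul_zero, add_zero]
    simp only [hi, Circle.smul_def]
    rw [integral_smul, integral_complex_ofReal, h]
    simp
  simp [hzero]


/-! ### Compact convex sets and potentials with controlled support. -/

/-- The convex hull of a compact subset of a finite-dimensional space is compact. -/
theorem isCompact_convexHull_of_isCompact {E : Type*} [NormedAddCommGroup E] [NormedSpace ℝ E]
    [FiniteDimensional ℝ E] {s : Set E} (hs : IsCompact s) : IsCompact (convexHull ℝ s) := by
  rcases s.eq_empty_or_nonempty with rfl | ⟨a, ha⟩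
  · simp
  -- Carathéodory: `n` points suffice, so the hull is a continuous image of the simplex times `s ^
  -- n`.
  let n := Module.finrank ℝ E + 1
  let S : Set ((Fin n → ℝ) × (Fin n → E)) := stdSimplex ℝ (Fin n) ×ˢ univ.pi fun _ => s
  have hS : IsCompact S := (isCompact_stdSimplex ℝ (Fin n)).prod (isCompact_univ_pi fun _ => hs)
  have hcont : Continuous fun q : (Fin n → ℝ) × (Fin n → E) => ∑ i, q.1 i • q.2 i := by fun_prop
  convert hS.image hcont
  refine Subset.antisymm (fun x hx => ?_) ?_
  · obtain ⟨ι, _, z, w, hz, hind, hw, hw1, hwx⟩ := eq_pos_convex_span_of_mem_convexHull hx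
    have hcard : Fintype.card ι ≤ Fintype.card (Fin n) := by
      simpa [n] using hind.card_le_finrank_succ.trans
        (Nat.succ_le_succ (Submodule.finrank_le _))
    obtain ⟨e⟩ := Function.Embedding.nonempty_of_card_le hcard
    have he (k : ι) : Function.extend e w 0 (e k) = w k := e.injective.extend_apply _ _ _
    have hze (k : ι) : Function.extend e z (fun _ => a) (e k) = z k := e.injective.extend_apply _ _ _
    have h0 (i : Fin n) (hi : i ∉ range e) : Function.extend e w 0 i = 0 :=
      Function.extend_apply' _ _ _ hi
    -- Unused slots get weight `0` and the point `a`, which keeps the tuple inside `s`.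
    refine ⟨(Function.extend e w 0, Function.extend e z fun _ => a), ⟨⟨fun i => ?_, ?_⟩, ?_⟩, ?_⟩
    · by_cases hi : i ∈ range e
      · obtain ⟨k, rfl⟩ := hi
        exact (hw k).le.trans_eq (he k).symm
      · exact (h0 i hi).ge
    · rw [← hw1]
      exact (Fintype.sum_of_injective e e.injective _ _ h0 fun k => (he k).symm).symm
    · intro i _
      by_cases hi : i ∈ range e
      · obtain ⟨k, rfl⟩ := hi
        simpa only [hze] using hz (mem_range_self k)
      · simpa only [Function.extend_apply' _ _ _ hi] using ha
    · change ∑ i, Function.extend e w 0 i • Function.extend e z (fun _ => a) i = x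
      rw [← hwx]
      refine (Fintype.sum_of_injective e e.injective _ _ (fun i hi => ?_) fun k => ?_).symm
      · rw [h0 i hi, zero_smul]
      · rw [he, hze]
  · rintro _ ⟨⟨w, z⟩, ⟨⟨hw0, hw1⟩, hz⟩, rfl⟩
    exact (convex_convexHull ℝ s).sum_mem (fun i _ => hw0 i) hw1
      fun i _ => subset_convexHull ℝ s (hz i (mem_univ i))

theorem eq_of_fderiv_eq_zero_off {f : Plane → ℝ} (hf : Differentiable ℝ f) {K H : Set Plane}
    (h0 : ∀ x ∉ K, fderiv ℝ f x = 0) (hH : Convex ℝ H) (hHo : IsOpen H) (hHK : Disjoint H K)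
    {x y : Plane} (hx : x ∈ H) (hy : y ∈ H) : f x = f y :=
  hHo.is_const_of_fderiv_eq_zero hH.isPreconnected hf.differentiableOn
    (fun z hz => h0 z (disjoint_left.1 hHK hz)) hx hy

/-- A function which is locally constant off a compact convex subset of the plane is constant off
that set. -/
theorem exists_eq_const_off_convex {f : Plane → ℝ} (hf : Differentiable ℝ f) {K : Set Plane}
    (hK : IsCompact K) (hKc : Convex ℝ K) (h0 : ∀ x ∉ K, fderiv ℝ f x = 0) :
    ∃ c, ∀ x ∉ K, f x = c := by
  obtain ⟨R, hR0, hR⟩ := hK.isBounded.exists_pos_norm_le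
  have hco (x : Plane) (hx : x ∈ K) (i : Fin 2) : |x i| ≤ R :=
    (PiLp.norm_apply_le x i).trans (hR x hx)
  have half (a : Plane →L[ℝ] ℝ) (r : ℝ) (ha : ∀ z ∈ K, a z ≤ r) {x y : Plane} (hx : r < a x)
      (hy : r < a y) : f x = f y := by
    refine eq_of_fderiv_eq_zero_off hf h0 (convex_halfSpace_gt a.isLinear r)
      (isOpen_lt continuous_const a.continuous) ?_ hx hy
    exact disjoint_left.2 fun z hz hzK => absurd (ha z hzK) (not_le.2 hz)
  have hpos (i : Fin 2) {x y : Plane} (hx : R < x i) (hy : R < y i) : f x = f y :=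
    half (EuclideanSpace.proj i) R (fun z hz => (abs_le.1 (hco z hz i)).2) hx hy
  have hneg (i : Fin 2) {x y : Plane} (hx : x i < -R) (hy : y i < -R) : f x = f y :=
    half (-EuclideanSpace.proj i) R (fun z hz => neg_le.1 (abs_le.1 (hco z hz i)).1)
      (lt_neg.1 hx) (lt_neg.1 hy)
  -- The left and right half-planes are linked through the upper one.
  have hfar {y : Plane} (hy : R < |y 0|) : f y = f !₂[R + 1, R + 1] := by
    rcases lt_abs.1 hy with h | h
    · exact hpos 0 h (by simp)
    · exact (hneg 0 (y := !₂[-(R + 1), R + 1]) (lt_neg.1 h) (by simp)).trans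
        (hpos 1 (by simp) (by simp))
  refine ⟨f !₂[R + 1, R + 1], fun x hx => ?_⟩
  obtain ⟨a, r, har, hrx⟩ := geometric_hahn_banach_closed_point hKc hK.isClosed hx
  have hval (z : Plane) : a z = z 0 * a (EuclideanSpace.single 0 1) +
      z 1 * a (EuclideanSpace.single 1 1) := by
    conv_lhs => rw [eq_sum_single z]
    simp
  set p := a (EuclideanSpace.single 0 1)
  set q := a (EuclideanSpace.single 1 1)
  -- Moving far in the direction `(σ, τ)` of the signs of `p` and `q` stays in the separating
  -- half-plane; `|σ| = 1` makes the first coordinate leave `[-R, R]`.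
  obtain ⟨σ, hσ, hσp⟩ : ∃ σ : ℝ, |σ| = 1 ∧ σ * p = |p| := by
    rcases abs_cases p with ⟨h, -⟩ | ⟨h, -⟩
    · exact ⟨1, by simp, by simp [h]⟩
    · exact ⟨-1, by simp, by simp [h]⟩
  obtain ⟨τ, hτq⟩ : ∃ τ : ℝ, τ * q = |q| := by
    rcases abs_cases q with ⟨h, -⟩ | ⟨h, -⟩
    · exact ⟨1, by simp [h]⟩
    · exact ⟨-1, by simp [h]⟩
  have hev : ∀ᶠ L : ℝ in Filter.atTop, r < L * (|p| + |q|) := by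
    -- The functional `a` can vanish only if `K` is empty; then `r < 0` and any `L` works.
    rcases (add_nonneg (abs_nonneg p) (abs_nonneg q)).eq_or_lt with h | h
    · have hp : p = 0 := abs_eq_zero.1 (by linarith [abs_nonneg p, abs_nonneg q])
      have hq : q = 0 := abs_eq_zero.1 (by linarith [abs_nonneg p, abs_nonneg q])
      rw [hval, hp, hq] at hrx
      rw [← h]
      exact .of_forall fun _ => by simpa using hrx
    · exact (Filter.tendsto_id.atTop_mul_const h).eventually_gt_atTop r
  obtain ⟨L, hLr, hLR⟩ := (hev.and (Filter.eventually_gt_atTop R)).exists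
  have hy : r < a !₂[L * σ, L * τ] := by
    rw [hval]
    simp only [Matrix.cons_val_zero, Matrix.cons_val_one, mul_assoc, hσp, hτq]
    linarith
  rw [half a r (fun z hz => (har z hz).le) hrx hy]
  refine hfar ?_
  simpa [abs_mul, hσ] using hLR.trans_le (le_abs_self L)

/-- The Poincaré lemma with supports: a smooth closed vector field vanishing off a compact convex
set is the gradient of a smooth function vanishing off that set. -/
theorem exists_potential {F : Fin 2 → Plane → ℝ} (hF : ∀ i, ContDiff ℝ ∞ (F i)) {K : Set Plane}
    (hK : IsCompact K) (hKc : Convex ℝ K) (h0 : ∀ x ∉ K, ∀ i, F i x = 0)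
    (hcurl : ∀ x, partialDeriv 0 (F 1) x = partialDeriv 1 (F 0) x) :
    ∃ φ : Plane → ℝ, ContDiff ℝ ∞ φ ∧ HasCompactSupport φ ∧ tsupport φ ⊆ K ∧
      ∀ x i, partialDeriv i φ x = F i x := by
  let P (i : Fin 2) : Plane →L[ℝ] ℝ := EuclideanSpace.proj i
  let W (x : Plane) : Plane →L[ℝ] ℝ := F 0 x • P 0 + F 1 x • P 1
  have hWs : ContDiff ℝ ∞ W :=
    ((hF 0).smul contDiff_const).add ((hF 1).smul contDiff_const)
  have hd (i : Fin 2) : Differentiable ℝ (F i) := (hF i).differentiable (by simp)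
  have hW' (x v w : Plane) : fderiv ℝ W x v w = fderiv ℝ (F 0) x v * w 0 +
      fderiv ℝ (F 1) x v * w 1 := by
    have : HasFDerivAt W ((fderiv ℝ (F 0) x).smulRight (P 0) +
        (fderiv ℝ (F 1) x).smulRight (P 1)) x :=
      ((hd 0 x).hasFDerivAt.smul_const (P 0)).add ((hd 1 x).hasFDerivAt.smul_const (P 1))
    rw [this.fderiv]
    simp [P]
  obtain ⟨f, hf⟩ := convex_univ.exists_forall_hasFDerivAt_of_fderiv_symmetric isOpen_univ
    (hWs.differentiable (by simp)).differentiableOn fun x _ v w => by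
      rw [hW', hW']
      simp only [fderiv_apply_eq, hcurl x]
      ring
  have hf' (x : Plane) : HasFDerivAt f (W x) x := hf x (mem_univ x)
  have hfd : Differentiable ℝ f := fun x => (hf' x).differentiableAt
  obtain ⟨c, hc⟩ := exists_eq_const_off_convex hfd hK hKc fun x hx => by
    rw [(hf' x).fderiv]
    simp [W, h0 x hx]
  have hfs : ContDiff ℝ ∞ f := by
    rw [contDiff_infty_iff_fderiv]
    exact ⟨hfd, by rwa [funext fun x => (hf' x).fderiv]⟩
  have hsupp : tsupport (fun x => f x - c) ⊆ K := by
    refine closure_minimal (fun x hx => ?_) hK.isClosed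
    by_contra hxK
    exact hx (by simp [hc x hxK])
  refine ⟨fun x => f x - c, hfs.sub contDiff_const,
    hK.of_isClosed_subset (isClosed_tsupport _) hsupp, hsupp, fun x i => ?_⟩
  rw [partialDeriv, fderiv_sub_const, (hf' x).fderiv]
  fin_cases i <;> simp [W, P]


/-! ### From vanishing ray transforms to compatibility conditions. -/

theorem exists_unit_orthogonal (ζ : Plane) :
    ∃ (ξ : Plane) (r : ℝ), ‖ξ‖ = 1 ∧ inner ℝ ξ ζ = 0 ∧ ζ 0 = r * ξ 1 ∧ ζ 1 = -(r * ξ 0) := by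
  rcases eq_or_ne ζ 0 with rfl | hζ
  · exact ⟨EuclideanSpace.single 0 1, 0, by simp⟩
  · have hn : ‖ζ‖ ≠ 0 := norm_ne_zero_iff.2 hζ
    refine ⟨‖ζ‖⁻¹ • !₂[-ζ 1, ζ 0], ‖ζ‖, ?_, ?_, ?_, ?_⟩
    · have h : ‖(!₂[-ζ 1, ζ 0] : Plane)‖ = ‖ζ‖ := by
        simp [EuclideanSpace.norm_eq, add_comm]
      rw [norm_smul, h, norm_inv, norm_norm, inv_mul_cancel₀ hn]
    · simp [PiLp.inner_apply]
      ring
    · simp [hn]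
    · simp [hn]

theorem curl_eq_zero_of_rayTransform {F : Fin 2 → Plane → ℝ} (hF : ∀ i, ContDiff ℝ ∞ (F i))
    (hc : ∀ i, HasCompactSupport (F i))
    (h : ∀ X ξ : Plane, ‖ξ‖ = 1 → ∫ t : ℝ, ∑ m, F m (X + t • ξ) * ξ m = 0) (x : Plane) :
    partialDeriv 0 (F 1) x - partialDeriv 1 (F 0) x = 0 := by
  have hd (i j : Fin 2) : Continuous (partialDeriv i (F j)) :=
    (contDiff_partialDeriv (hF j) i).continuous
  have hdc (i j : Fin 2) : HasCompactSupport (partialDeriv i (F j)) :=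
    hasCompactSupport_partialDeriv (hc j) i
  suffices H : ∀ x, partialDeriv 0 (F 1) x + (-1) * partialDeriv 1 (F 0) x = 0 by
    linarith [H x]
  have hA (c : ℝ) (i j : Fin 2) : Continuous fun x => c * partialDeriv i (F j) x :=
    continuous_const.mul (hd i j)
  have hAc (c : ℝ) (i j : Fin 2) : HasCompactSupport fun x => c * partialDeriv i (F j) x :=
    (hdc i j).mul_left
  have hB (c : ℝ) (i : Fin 2) : Continuous fun x => c * F i x :=
    continuous_const.mul (hF i).continuous
  have hBc (c : ℝ) (i : Fin 2) : HasCompactSupport fun x => c * F i x := (hc i).mul_left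
  refine eq_zero_of_realFourier_eq_zero ((hd 0 1).add (hA (-1) 1 0))
    ((hdc 0 1).add (hAc (-1) 1 0)) fun ζ => ?_
  obtain ⟨ξ, r, hξ, hort, h0, h1⟩ := exists_unit_orthogonal ζ
  have key : realFourier (fun x => ξ 0 * F 0 x + ξ 1 * F 1 x) ζ = 0 := by
    refine realFourier_eq_zero_of_integral_line ((hB _ 0).add (hB _ 1))
      ((hBc _ 0).add (hBc _ 1)) hξ (fun X => ?_) hort
    rw [← h X ξ hξ]
    congr 1
    ext t
    simp only [Fin.sum_univ_two, Pi.add_apply]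
    ring
  rw [realFourier_add (hB _ 0) (hBc _ 0) (hB _ 1) (hBc _ 1), realFourier_const_mul,
    realFourier_const_mul] at key
  rw [realFourier_add (hd 0 1) (hdc 0 1) (hA _ 1 0) (hAc _ 1 0),
    realFourier_const_mul, realFourier_partialDeriv (hF 1) (hc 1),
    realFourier_partialDeriv (hF 0) (hc 0), h0, h1]
  push_cast
  -- Since `ζ = r (ξ 1, -ξ 0)`, the symbol of the curl at `ζ` is this multiple of the contraction
  -- with `ξ`.
  linear_combination (2 * Real.pi * Complex.I * r) * key

/-- The second-order analogue of the curl argument: the symbol `ζ₀² c + ζ₁² a - 2 ζ₀ ζ₁ b` equals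
`r²` times the double contraction with `ξ`. -/
theorem saintVenant_eq_zero_of_rayTransform {a b c : Plane → ℝ} (ha : ContDiff ℝ ∞ a)
    (hb : ContDiff ℝ ∞ b) (hc : ContDiff ℝ ∞ c) (hac : HasCompactSupport a)
    (hbc : HasCompactSupport b) (hcc : HasCompactSupport c)
    (h : ∀ X ξ : Plane, ‖ξ‖ = 1 → ∫ t : ℝ, (ξ 0 ^ 2 * a (X + t • ξ) +
      2 * ξ 0 * ξ 1 * b (X + t • ξ) + ξ 1 ^ 2 * c (X + t • ξ)) = 0) (x : Plane) :
    partialDeriv 0 (partialDeriv 0 c) x + partialDeriv 1 (partialDeriv 1 a) x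
      - 2 * partialDeriv 0 (partialDeriv 1 b) x = 0 := by
  have hd {f : Plane → ℝ} (hf : ContDiff ℝ ∞ f) (i j : Fin 2) :
      Continuous (partialDeriv i (partialDeriv j f)) :=
    (contDiff_partialDeriv (contDiff_partialDeriv hf j) i).continuous
  have hdc {f : Plane → ℝ} (hf : HasCompactSupport f) (i j : Fin 2) :
      HasCompactSupport (partialDeriv i (partialDeriv j f)) :=
    hasCompactSupport_partialDeriv (hasCompactSupport_partialDeriv hf j) i
  have hFT {f : Plane → ℝ} (hf : ContDiff ℝ ∞ f) (hfc : HasCompactSupport f) (i j : Fin 2)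
      (ζ : Plane) : realFourier (partialDeriv i (partialDeriv j f)) ζ =
      (2 * Real.pi * Complex.I) ^ 2 * ζ i * ζ j * realFourier f ζ := by
    rw [realFourier_partialDeriv (contDiff_partialDeriv hf j)
      (hasCompactSupport_partialDeriv hfc j), realFourier_partialDeriv hf hfc]
    ring
  suffices H : ∀ x, partialDeriv 0 (partialDeriv 0 c) x + partialDeriv 1 (partialDeriv 1 a) x +
      (-2) * partialDeriv 0 (partialDeriv 1 b) x = 0 by
    linarith [H x]
  have hE : Continuous fun x =>
      partialDeriv 0 (partialDeriv 0 c) x + partialDeriv 1 (partialDeriv 1 a) x :=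
    (hd hc 0 0).add (hd ha 1 1)
  have hEc : HasCompactSupport fun x =>
      partialDeriv 0 (partialDeriv 0 c) x + partialDeriv 1 (partialDeriv 1 a) x :=
    (hdc hcc 0 0).add (hdc hac 1 1)
  have hD : Continuous fun x => (-2) * partialDeriv 0 (partialDeriv 1 b) x :=
    continuous_const.mul (hd hb 0 1)
  have hDc : HasCompactSupport fun x => (-2) * partialDeriv 0 (partialDeriv 1 b) x :=
    (hdc hbc 0 1).mul_left
  refine eq_zero_of_realFourier_eq_zero (hE.add hD) (hEc.add hDc) fun ζ => ?_
  obtain ⟨ξ, r, hξ, hort, h0, h1⟩ := exists_unit_orthogonal ζ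
  have hA : Continuous fun x => ξ 0 ^ 2 * a x := continuous_const.mul ha.continuous
  have hB : Continuous fun x => 2 * ξ 0 * ξ 1 * b x := continuous_const.mul hb.continuous
  have hC : Continuous fun x => ξ 1 ^ 2 * c x := continuous_const.mul hc.continuous
  have hAc : HasCompactSupport fun x => ξ 0 ^ 2 * a x := hac.mul_left
  have hBc : HasCompactSupport fun x => 2 * ξ 0 * ξ 1 * b x := hbc.mul_left
  have hCc : HasCompactSupport fun x => ξ 1 ^ 2 * c x := hcc.mul_left
  have hAB : Continuous fun x => ξ 0 ^ 2 * a x + 2 * ξ 0 * ξ 1 * b x := hA.add hB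
  have hABc : HasCompactSupport fun x => ξ 0 ^ 2 * a x + 2 * ξ 0 * ξ 1 * b x := hAc.add hBc
  have key : realFourier (fun x => ξ 0 ^ 2 * a x + 2 * ξ 0 * ξ 1 * b x + ξ 1 ^ 2 * c x) ζ = 0 :=
    realFourier_eq_zero_of_integral_line (hAB.add hC) (hABc.add hCc) hξ (fun X => h X ξ hξ) hort
  rw [realFourier_add hAB hABc hC hCc, realFourier_add hA hAc hB hBc,
    realFourier_const_mul, realFourier_const_mul, realFourier_const_mul] at key
  rw [realFourier_add hE hEc     hD hDc,
    realFourier_add (hd hc 0 0) (hdc hcc 0 0) (hd ha 1 1) (hdc hac 1 1), realFourier_const_mul,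
    hFT hc hcc, hFT ha hac, hFT hb hbc, h0, h1]
  push_cast at key ⊢
  linear_combination ((2 * Real.pi * Complex.I) ^ 2 * r ^ 2) * key

/-! ### Symmetrized gradients and the Saint-Venant condition. -/

/-- A symmetric tensor field satisfying the Saint-Venant compatibility condition is the symmetrized
gradient of a vector field supported in the same compact convex set. -/
theorem exists_tensor_potential {U : Fin 2 → Fin 2 → Plane → ℝ}
    (hU : ∀ i j, ContDiff ℝ ∞ (U i j)) (hsymm : U 1 0 = U 0 1) {K : Set Plane} (hK : IsCompact K)
    (hKc : Convex ℝ K) (h0 : ∀ i j, tsupport (U i j) ⊆ K)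
    (hSV : ∀ x, partialDeriv 0 (partialDeriv 0 (U 1 1)) x
      + partialDeriv 1 (partialDeriv 1 (U 0 0)) x
      - 2 * partialDeriv 0 (partialDeriv 1 (U 0 1)) x = 0) :
    ∃ v : Fin 2 → Plane → ℝ, (∀ i, ContDiff ℝ ∞ (v i)) ∧ (∀ i, tsupport (v i) ⊆ K) ∧
      ∀ x i j, U i j x = (1 / 2 : ℝ) * (partialDeriv i (v j) x + partialDeriv j (v i) x) := by
  have hd (i j k : Fin 2) : ContDiff ℝ ∞ (partialDeriv k (U i j)) :=
    contDiff_partialDeriv (hU i j) k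
  have hU0 {x : Plane} (hx : x ∉ K) (i j : Fin 2) : U i j x = 0 :=
    image_eq_zero_of_notMem_tsupport fun h => hx (h0 i j h)
  -- `ψ` plays the rotation `(∂₀v₁ - ∂₁v₀)/2`: its gradient is determined by `U`, and closedness of
  -- that gradient is exactly `hSV`.
  obtain ⟨ψ, hψ, -, hψK, hψd⟩ := exists_potential
    (F := fun k x => partialDeriv 0 (U 1 k) x - partialDeriv 1 (U 0 k) x)
    (fun k => (hd 1 k 0).sub (hd 0 k 1)) hK hKc
    (fun x hx k => by
      rw [partialDeriv_eq_zero_of_notMem 0 fun h => hx (h0 1 k h),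
        partialDeriv_eq_zero_of_notMem 1 fun h => hx (h0 0 k h), sub_zero])
    (fun x => by
      rw [partialDeriv_sub (hd 1 1 0) (hd 0 1 1), partialDeriv_sub (hd 1 0 0) (hd 0 0 1), hsymm,
        partialDeriv_comm (hU 0 1) 1 0]
      linarith [hSV x])
  have hψ0 {x : Plane} (hx : x ∉ K) : ψ x = 0 :=
    image_eq_zero_of_notMem_tsupport fun h => hx (hψK h)
  -- Subtracting or adding `ψ` in the off-diagonal entry restores the full Jacobian, whose rows are
  -- the gradients of `p` and `q`.
  obtain ⟨p, hp, -, hpK, hpd⟩ := exists_potential (F := ![U 0 0, fun x => U 0 1 x - ψ x])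
    (by intro i; fin_cases i; exacts [hU 0 0, (hU 0 1).sub hψ]) hK hKc
    (by intro x hx i; fin_cases i <;> simp [hU0 hx, hψ0 hx])
    (fun x => by
      change partialDeriv 0 (fun x => U 0 1 x - ψ x) x = partialDeriv 1 (U 0 0) x
      rw [partialDeriv_sub (hU 0 1) hψ, hψd, hsymm]
      ring)
  obtain ⟨q, hq, -, hqK, hqd⟩ := exists_potential (F := ![fun x => U 0 1 x + ψ x, U 1 1])
    (by intro i; fin_cases i; exacts [(hU 0 1).add hψ, hU 1 1]) hK hKc
    (by intro x hx i; fin_cases i <;> simp [hU0 hx, hψ0 hx])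
    (fun x => by
      change partialDeriv 0 (U 1 1) x = partialDeriv 1 (fun x => U 0 1 x + ψ x) x
      rw [partialDeriv_add (hU 0 1) hψ, hψd]
      ring)
  refine ⟨![p, q], ?_, ?_, fun x i j => ?_⟩
  · intro i; fin_cases i; exacts [hp, hq]
  · intro i; fin_cases i; exacts [hpK, hqK]
  · fin_cases i <;> fin_cases j <;> simp [hpd, hqd, hsymm] <;> ring

theorem saintVenant_of_symmGrad {v : Fin 2 → Plane → ℝ} (hv : ∀ i, ContDiff ℝ ∞ (v i))
    {U : Fin 2 → Fin 2 → Plane → ℝ}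
    (h : ∀ x i j, U i j x = (1 / 2 : ℝ) * (partialDeriv i (v j) x + partialDeriv j (v i) x))
    (x : Plane) :
    partialDeriv 0 (partialDeriv 0 (U 1 1)) x + partialDeriv 1 (partialDeriv 1 (U 0 0)) x
      - 2 * partialDeriv 0 (partialDeriv 1 (U 0 1)) x = 0 := by
  have hd (i j : Fin 2) : ContDiff ℝ ∞ (partialDeriv i (v j)) := contDiff_partialDeriv (hv j) i
  have hdd (i j k : Fin 2) : ContDiff ℝ ∞ (partialDeriv i (partialDeriv j (v k))) :=
    contDiff_partialDeriv (hd j k) i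
  have key (i j k l : Fin 2) : partialDeriv k (partialDeriv l (U i j)) x = (1 / 2 : ℝ) *
      (partialDeriv k (partialDeriv l (partialDeriv i (v j))) x +
        partialDeriv k (partialDeriv l (partialDeriv j (v i))) x) := by
    have e1 : partialDeriv l (U i j) = fun y => (1 / 2 : ℝ) *
        (partialDeriv l (partialDeriv i (v j)) y + partialDeriv l (partialDeriv j (v i)) y) := by
      ext y
      rw [show U i j = fun x => (1 / 2 : ℝ) * (partialDeriv i (v j) x + partialDeriv j (v i) x)
        from funext fun x => h x i j, partialDeriv_const_mul ((hd i j).add (hd j i)),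
        partialDeriv_add (hd i j) (hd j i)]
    rw [e1, partialDeriv_const_mul ((hdd l i j).add (hdd l j i)),
      partialDeriv_add (hdd l i j) (hdd l j i)]
  have hc (i j k : Fin 2) : partialDeriv i (partialDeriv j (v k)) =
      partialDeriv j (partialDeriv i (v k)) := funext (partialDeriv_comm (hv k) i j)
  rw [key, key, key, hc 1 0 1, partialDeriv_comm (hd 1 0) 0 1, hc 0 1 0]
  ring

/-! ### Assembling the equivalences. -/

theorem integral_grad_line_eq_zero {φ : Plane → ℝ} (hφ : ContDiff ℝ ∞ φ)
    (hc : HasCompactSupport φ) (X : Plane) {ξ : Plane} (hξ : ‖ξ‖ = 1) :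
    ∫ t : ℝ, (ξ 0 * partialDeriv 0 φ (X + t • ξ) + ξ 1 * partialDeriv 1 φ (X + t • ξ)) = 0 := by
  simpa only [fderiv_apply_eq] using integral_line_fderiv_eq_zero hφ hc X hξ

theorem contDiff_apply_coord {w : Plane → Plane} (hw : ContDiff ℝ ∞ w) (i : Fin 2) :
    ContDiff ℝ ∞ (fun x => w x i) :=
  (contDiff_piLp 2).1 hw i

theorem tsupport_comp_subset_of_zero {α β : Type*} [Zero α] [Zero β] {g : α → β} (hg : g 0 = 0)
    (f : Plane → α) : tsupport (fun x => g (f x)) ⊆ tsupport f :=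
  closure_mono (Function.support_comp_subset hg f)

theorem vector_tfae (w : Plane → Plane) (hw : ContDiff ℝ ∞ w) (hwc : HasCompactSupport w) :
    List.TFAE [
      ∀ X ξ : Plane, ‖ξ‖ = 1 → vectorRayTransform w X ξ = 0,
      ∃ φ : Plane → ℝ, ContDiff ℝ ∞ φ ∧ HasCompactSupport φ ∧
        tsupport φ ⊆ convexHull ℝ (tsupport w) ∧
        ∀ (x : Plane) (i : Fin 2), w x i = partialDeriv i φ x,
      ∀ x : Plane, partialDeriv 0 (fun y => w y 1) x - partialDeriv 1 (fun y => w y 0) x = 0] := by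
  have hs (i : Fin 2) : ContDiff ℝ ∞ (fun x => w x i) := contDiff_apply_coord hw i
  tfae_have 1 → 3 := fun h => curl_eq_zero_of_rayTransform (F := fun i x => w x i) hs
    (fun i => hwc.comp_left (g := fun v : Plane => v i) (by simp)) h
  tfae_have 3 → 2 := fun h => by
    obtain ⟨φ, hφ, hφc, hφK, hφd⟩ := exists_potential (F := fun i x => w x i) hs
      (isCompact_convexHull_of_isCompact hwc) (convex_convexHull ℝ (tsupport w))
      (fun x hx i => by
        rw [image_eq_zero_of_notMem_tsupport fun h => hx (subset_convexHull ℝ _ h)]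
        simp)
      (fun x => sub_eq_zero.1 (h x))
    exact ⟨φ, hφ, hφc, hφK, fun x i => (hφd x i).symm⟩
  tfae_have 2 → 1 := by
    rintro ⟨φ, hφ, hφc, -, hφd⟩ X ξ hξ
    rw [← integral_grad_line_eq_zero hφ hφc X hξ]
    simp only [vectorRayTransform, Fin.sum_univ_two, hφd, mul_comm]
  tfae_finish

theorem tensor_tfae (u : Plane → Matrix (Fin 2) (Fin 2) ℝ)
    (hu : ∀ i j : Fin 2, ContDiff ℝ ∞ (fun x => u x i j)) (huc : HasCompactSupport u)
    (hsymm : ∀ x : Plane, (u x).IsSymm) :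
    List.TFAE [
      ∀ X ξ : Plane, ‖ξ‖ = 1 → tensorRayTransform u X ξ = 0,
      ∃ v : Plane → Plane, ContDiff ℝ ∞ v ∧ HasCompactSupport v ∧
        tsupport v ⊆ convexHull ℝ (tsupport u) ∧
        ∀ (x : Plane) (i j : Fin 2),
          u x i j = (1 / 2 : ℝ) * (partialDeriv i (fun y => v y j) x
            + partialDeriv j (fun y => v y i) x),
      ∀ x : Plane,
        partialDeriv 0 (partialDeriv 0 (fun y => u y 1 1)) x
          + partialDeriv 1 (partialDeriv 1 (fun y => u y 0 0)) x
          - 2 * partialDeriv 0 (partialDeriv 1 (fun y => u y 0 1)) x = 0] := by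
  have h10 (x : Plane) : u x 1 0 = u x 0 1 := (hsymm x).apply 0 1
  have hc (i j : Fin 2) : HasCompactSupport fun x => u x i j :=
    huc.comp_left (g := fun A : Matrix (Fin 2) (Fin 2) ℝ => A i j) (by simp)
  tfae_have 1 → 3 := fun h => saintVenant_eq_zero_of_rayTransform (hu 0 0) (hu 0 1) (hu 1 1)
    (hc 0 0) (hc 0 1) (hc 1 1) fun X ξ hξ => by
      rw [← h X ξ hξ, tensorRayTransform]
      congr 1
      ext t
      simp only [Fin.sum_univ_two, h10]
      ring
  tfae_have 3 → 2 := fun h => by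
    have hK : IsCompact (convexHull ℝ (tsupport u)) :=
      isCompact_convexHull_of_isCompact huc
    obtain ⟨v, hv, hvK, hvd⟩ := exists_tensor_potential (U := fun i j x => u x i j) hu
      (funext h10) hK (convex_convexHull ℝ (tsupport u))
      (fun i j => (tsupport_comp_subset_of_zero
        (g := fun A : Matrix (Fin 2) (Fin 2) ℝ => A i j) (by simp) u).trans
        (subset_convexHull ℝ _)) h
    have hsupp : tsupport (fun x => (!₂[v 0 x, v 1 x] : Plane)) ⊆ convexHull ℝ (tsupport u) := by
      refine closure_minimal (fun x hx => ?_) hK.isClosed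
      by_contra hxK
      refine hx ?_
      ext i
      fin_cases i
      · simpa using image_eq_zero_of_notMem_tsupport fun h => hxK (hvK 0 h)
      · simpa using image_eq_zero_of_notMem_tsupport fun h => hxK (hvK 1 h)
    have hcomp (i : Fin 2) : (fun x => (!₂[v 0 x, v 1 x] : Plane) i) = v i := by
      fin_cases i <;> rfl
    refine ⟨fun x => !₂[v 0 x, v 1 x], (contDiff_piLp 2).2 fun i => ?_,
      hK.of_isClosed_subset (isClosed_tsupport _) hsupp, hsupp, fun x i j => ?_⟩
    · rw [hcomp]; exact hv i
    · rw [hcomp, hcomp]; exact hvd x i j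
  tfae_have 2 → 3 := by
    rintro ⟨v, hv, -, -, hvd⟩
    exact saintVenant_of_symmGrad (v := fun i x => v x i) (U := fun i j x => u x i j)
      (contDiff_apply_coord hv) hvd
  tfae_have 2 → 1 := by
    rintro ⟨v, hv, hvc, -, hvd⟩ X ξ hξ
    have hvs (i : Fin 2) : ContDiff ℝ ∞ fun x => ξ i * v x i :=
      contDiff_const.mul (contDiff_apply_coord hv i)
    have hvc' (i : Fin 2) : HasCompactSupport fun x => ξ i * v x i :=
      hvc.comp_left (g := fun p : Plane => ξ i * p i) (by simp)
    -- With `ξ` frozen, the integrand is the derivative along the line of the scalar `ξ · v`.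
    rw [← integral_grad_line_eq_zero ((hvs 0).add (hvs 1)) ((hvc' 0).add (hvc' 1)) X hξ]
    rw [tensorRayTransform]
    congr 1
    ext t
    simp only [Fin.sum_univ_two, hvd, partialDeriv_add (hvs 0) (hvs 1),
      partialDeriv_const_mul (contDiff_apply_coord hv _)]
    ring
  tfae_finish

end RayKernel

theorem theorem1 :
    (∀ w : RayKernel.Plane → RayKernel.Plane, ContDiff ℝ ∞ w → HasCompactSupport w →
      List.TFAE [
        ∀ X ξ : RayKernel.Plane, ‖ξ‖ = 1 → RayKernel.vectorRayTransform w X ξ = 0,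
        ∃ φ : RayKernel.Plane → ℝ, ContDiff ℝ ∞ φ ∧ HasCompactSupport φ ∧
          tsupport φ ⊆ convexHull ℝ (tsupport w) ∧
          ∀ (x : RayKernel.Plane) (i : Fin 2), w x i = RayKernel.partialDeriv i φ x,
        ∀ x : RayKernel.Plane,
          RayKernel.partialDeriv 0 (fun y => w y 1) x
            - RayKernel.partialDeriv 1 (fun y => w y 0) x = 0]) ∧
    (∀ u : RayKernel.Plane → Matrix (Fin 2) (Fin 2) ℝ,
      (∀ i j : Fin 2, ContDiff ℝ ∞ (fun x => u x i j)) → HasCompactSupport u →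
      (∀ x : RayKernel.Plane, (u x).IsSymm) →
      List.TFAE [
        ∀ X ξ : RayKernel.Plane, ‖ξ‖ = 1 → RayKernel.tensorRayTransform u X ξ = 0,
        ∃ v : RayKernel.Plane → RayKernel.Plane, ContDiff ℝ ∞ v ∧ HasCompactSupport v ∧
          tsupport v ⊆ convexHull ℝ (tsupport u) ∧
          ∀ (x : RayKernel.Plane) (i j : Fin 2),
            u x i j = (1 / 2 : ℝ) * (RayKernel.partialDeriv i (fun y => v y j) x
              + RayKernel.partialDeriv j (fun y => v y i) x),
        ∀ x : RayKernel.Plane,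
          RayKernel.partialDeriv 0 (RayKernel.partialDeriv 0 (fun y => u y 1 1)) x
            + RayKernel.partialDeriv 1 (RayKernel.partialDeriv 1 (fun y => u y 0 0)) x
            - 2 * RayKernel.partialDeriv 0 (RayKernel.partialDeriv 1 (fun y => u y 0 1)) x
            = 0]) := by
  exact ⟨RayKernel.vector_tfae, RayKernel.tensor_tfae⟩
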